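/- Let $X$ be a Banach lattice, that is, a real Banach space that is also a vector lattice and in which $|x|\le|y|$ implies $\|x\|\le\|y\|$. A net $(x_\alpha)_{\alpha\in\Gamma}$ in $X$ converges in order to $x$ if there is a net $(a_\gamma)_{\gamma\in\Lambda}$ in $X$, possibly over another index set, with $a_\gamma\downarrow 0$ such that for every $\gamma\in\Lambda$ there is $\alpha_0\in\Gamma$ with $|x_\alpha-x|\le a_\gamma$ for all $\alpha\ge\alpha_0$. It uo-converges to $x$ if $|x_\alpha-x|\wedge y$ converges in order to $0$ for every $y\in X$ with $y\ge 0$. It is uo-Cauchy if the net $(x_\alpha-x_{\alpha'})_{(\alpha,\alpha')\in\Gamma\times\Gamma}$ uo-converges to $0$, where $\Gamma\times\Gamma$ carries the product order. The order continuous dual $X_n^\sim$ is the space of all linear functionals $f\colon X\to\mathbb{R}$ such that $f(x_\alpha)\to 0$ whenever $(x_\alpha)$ converges in order to $0$. The Banach lattice $X$ is order continuous if $a_\gamma\downarrow 0$ in $X$ implies $\|a_\gamma\|\to 0$. Theorem. (i) If $X_n^\sim$ separates the points of $X$, then every norm bounded increasing net of positive elements ($x_\alpha\ge 0$) of $X$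 is uo-Cauchy in $X$. (ii) If $X$ is order continuous, then $X_n^\sim$ separates the points of $X$. -/

import Mathlib

open Filter Topology

universe u v

/-- Order convergence of a net `x : Γ → X` to `l` in a vector lattice `X`: there is a net
`a : Λ → X` with `a ↓ 0` such that for every `γ` one has `|x α - l| ≤ a γ` for all large `α`.
Passing from a decreasing net to its range (with the reversed order) shows that index sets `Λ`
in the universe of `X` are enough. -/
def OrderTendsto {X : Type u} [Lattice X] [AddCommGroup X] {Γ : Type v} [Preorder Γ]
    (x : Γ → X) (l : X) : Prop :=
  ∃ (Λ : Type u) (_ : Preorder Λ) (_ : IsDirectedOrder Λ) (_ : Nonempty Λ) (a : Λ → X),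
    Antitone a ∧ IsGLB (Set.range a) 0 ∧
      ∀ γ : Λ, ∃ α₀ : Γ, ∀ α : Γ, α₀ ≤ α → |x α - l| ≤ a γ

/-- Unbounded order convergence of a net: `|x α - l| ⊓ y` converges in order to `0`
for every `y ≥ 0`. -/
def UOTendsto {X : Type u} [Lattice X] [AddCommGroup X] {Γ : Type v} [Preorder Γ]
    (x : Γ → X) (l : X) : Prop :=
  ∀ y : X, 0 ≤ y → OrderTendsto (fun α => |x α - l| ⊓ y) 0

/-- A net is uo-Cauchy if the doubly indexed net `x α - x α'`, over `Γ × Γ` with the product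
order, uo-converges to `0`. -/
def UOCauchy {X : Type u} [Lattice X] [AddCommGroup X] {Γ : Type v} [Preorder Γ]
    (x : Γ → X) : Prop :=
  UOTendsto (fun p : Γ × Γ => x p.1 - x p.2) 0

/-- A linear functional `f` is order continuous if `f (x α) → 0` for every net `x` that converges
in order to `0`. Nets indexed in the universe of `X` are enough: if `f (x α)` does not tend to `0`
for some net `x` dominated by `a ↓ 0`, then for some `ε > 0` the pairs `(a γ, z)` with `|z| ≤ a γ`
and `ε ≤ |f z|`, ordered by decreasing first component, index a net of the same kind. -/
def IsOrderContinuousFunctional {X : Type u} [Lattice X] [AddCommGroup X] [Module ℝ X]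
    (f : X →ₗ[ℝ] ℝ) : Prop :=
  ∀ (Γ : Type u) [Preorder Γ] [IsDirectedOrder Γ] [Nonempty Γ] (x : Γ → X),
    OrderTendsto x 0 → Tendsto (fun α => f (x α)) atTop (𝓝 0)

/-- The order continuous dual of a vector lattice. -/
def orderContinuousDual (X : Type u) [Lattice X] [AddCommGroup X] [Module ℝ X] :
    Submodule ℝ (X →ₗ[ℝ] ℝ) where
  carrier := {f | IsOrderContinuousFunctional f}
  zero_mem' := by
    intro Γ _ _ _ x _
    simp
  add_mem' := by
    intro f g hf hg Γ _ _ _ x hx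
    simpa using (hf Γ x hx).add (hg Γ x hx)
  smul_mem' := by
    intro c f hf Γ _ _ _ x hx
    simpa using (hf Γ x hx).const_mul c

/-- The order continuous dual separates the points of `X`. -/
def OrderContinuousDualSeparates (X : Type u) [Lattice X] [AddCommGroup X] [Module ℝ X] : Prop :=
  ∀ x y : X, x ≠ y → ∃ f ∈ orderContinuousDual X, f x ≠ f y

/-- The norm of `X` is order continuous: `a ↓ 0` implies `‖a γ‖ → 0`. (A decreasing net may be
replaced by its range, so index sets in the universe of `X` are enough.) -/
def IsOrderContinuousNorm (X : Type u) [Lattice X] [NormedAddCommGroup X] : Prop :=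
  ∀ (Λ : Type u) [Preorder Λ] [IsDirectedOrder Λ] [Nonempty Λ] (a : Λ → X),
    Antitone a → IsGLB (Set.range a) 0 → Tendsto (fun γ => ‖a γ‖) atTop (𝓝 0)

/-! (i) Let `v` lie below every eventual upper bound of `|x α - x α'| ⊓ y`. If `v⁺ ≠ 0`, some order
continuous `f` has `f v⁺ > 0`. Its Riesz–Kantorovich positive part `f⁺` is additive on the cone,
order continuous, and, by completeness, bounded on norm bounded positive sets. So `f⁺ (x α)`
increases to a finite `s`, and past a suitable `β` it varies by less than `f v⁺ / 2`. Order
continuity then yields an upper bound `u` of the tail `(x δ - x β) ⊓ y` with `f⁺ u < f v⁺`. But `u`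
is an eventual upper bound, so `v⁺ ≤ u` and `f v⁺ ≤ f⁺ u`, a contradiction. (ii) An order continuous
norm makes every bounded functional order continuous; Hahn–Banach does the rest. -/

/-- In a normed lattice the norm is monotone on the positive cone. -/
theorem norm_le_norm_of_nonneg_of_le {X : Type u} [NormedAddCommGroup X] [Lattice X]
    [IsOrderedAddMonoid X] [HasSolidNorm X] {x y : X} (hx : 0 ≤ x) (hxy : x ≤ y) : ‖x‖ ≤ ‖y‖ := by
  apply norm_le_norm_of_abs_le_abs
  rwa [abs_of_nonneg hx, abs_of_nonneg (hx.trans hxy)]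

/-- A normed lattice is Archimedean. -/
theorem eq_zero_of_forall_nsmul_le {X : Type u} [NormedAddCommGroup X] [NormedSpace ℝ X]
    [Lattice X] [IsOrderedAddMonoid X] [HasSolidNorm X] {v w : X} (hv : 0 ≤ v)
    (h : ∀ n : ℕ, n • v ≤ w) : v = 0 := by
  by_contra hne
  obtain ⟨n, hn⟩ := exists_nat_gt (‖w‖ / ‖v‖)
  have hpos : 0 < ‖v‖ := norm_pos_iff.mpr hne
  have h1 := norm_le_norm_of_nonneg_of_le (nsmul_nonneg hv n) (h n)
  rw [← Nat.cast_smul_eq_nsmul ℝ, norm_smul, Real.norm_natCast] at h1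
  rw [div_lt_iff₀ hpos] at hn
  linarith

/-- The Riesz–Kantorovich formula for the positive part of a linear functional; it is the positive
part on the positive cone. -/
noncomputable def rieszPosPart {X : Type u} [Lattice X] [AddCommGroup X] [Module ℝ X]
    (f : X →ₗ[ℝ] ℝ) (x : X) : ℝ :=
  sSup (f '' Set.Icc 0 x)

theorem OrderTendsto.of_antitone {X : Type u} [Lattice X] [AddCommGroup X] {Γ : Type u}
    [Preorder Γ] [IsDirectedOrder Γ] [Nonempty Γ] {x a : Γ → X} (ha : Antitone a)
    (ha0 : IsGLB (Set.range a) 0) (hx : ∀ γ, |x γ| ≤ a γ) : OrderTendsto x 0 :=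
  ⟨Γ, inferInstance, inferInstance, inferInstance, a, ha, ha0, fun γ => ⟨γ, fun α hα => by
    simpa using (hx α).trans (ha hα)⟩⟩

theorem rieszPosPart_le {X : Type u} [Lattice X] [AddCommGroup X] [Module ℝ X]
    {f : X →ₗ[ℝ] ℝ} {x : X} {c : ℝ} (hx : 0 ≤ x) (h : ∀ u, 0 ≤ u → u ≤ x → f u ≤ c) :
    rieszPosPart f x ≤ c := by
  refine csSup_le ⟨f 0, 0, ⟨le_rfl, hx⟩, rfl⟩ ?_
  rintro _ ⟨u, hu, rfl⟩
  exact h u hu.1 hu.2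

/-- In a normed lattice, a nonempty set that is bounded above has infimal distance zero to the set
of its upper bounds. -/
theorem isGLB_upperBounds_sub {X : Type u} [NormedAddCommGroup X] [NormedSpace ℝ X] [Lattice X]
    [IsOrderedAddMonoid X] [HasSolidNorm X] {W : Set X} (hne : W.Nonempty) (hb : BddAbove W) :
    IsGLB {d | ∃ u ∈ upperBounds W, ∃ w ∈ W, u - w = d} 0 := by
  obtain ⟨u₀, hu₀⟩ := hb
  obtain ⟨w₀, hw₀⟩ := hne
  refine ⟨?_, fun v hv => ?_⟩
  · rintro _ ⟨u, hu, w, hw, rfl⟩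
    exact sub_nonneg.mpr (hu hw)
  · have hle {u w : X} (hu : u ∈ upperBounds W) (hw : w ∈ W) : v ⊔ 0 ≤ u - w :=
      sup_le (hv ⟨u, hu, w, hw, rfl⟩) (sub_nonneg.mpr (hu hw))
    -- Subtracting `v⁺` from an upper bound leaves an upper bound, so this can be iterated against
    -- the Archimedean property.
    have hmem (n : ℕ) : u₀ - n • (v ⊔ 0) ∈ upperBounds W := by
      induction n with
      | zero => simpa using hu₀
      | succ n ih =>
        intro w hw
        rw [succ_nsmul, ← sub_sub, le_sub_comm]
        exact hle ih hw
    have h0 : v ⊔ 0 = 0 := eq_zero_of_forall_nsmul_le (w := u₀ - w₀) le_sup_right fun n => by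
      rw [le_sub_comm]
      exact hmem n hw₀
    exact sup_eq_right.mp h0

/-- If the order continuous dual separates points, it contains for every `z ≠ 0` a functional
that is positive at `z`. -/
theorem OrderContinuousDualSeparates.exists_pos {X : Type u} [Lattice X] [AddCommGroup X]
    [Module ℝ X] (h : OrderContinuousDualSeparates X) {z : X} (hz : z ≠ 0) : ∃ f : X →ₗ[ℝ] ℝ, IsOrderContinuousFunctional f ∧ 0 < f z := by
  obtain ⟨f, hf, hfz⟩ := h z 0 hz
  rw [map_zero] at hfz
  rcases lt_or_gt_of_ne hfz with hneg | hpos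
  · exact ⟨-f, (orderContinuousDual X).neg_mem hf, by simpa using hneg⟩
  · exact ⟨f, hf, hpos⟩

/-- A net converges in order to `0` as soon as its eventual upper bounds have infimum `0`. -/
theorem OrderTendsto.of_isGLB {X : Type u} [Lattice X] [AddCommGroup X] {Γ : Type v}
    [Preorder Γ] [IsDirectedOrder Γ] {x : Γ → X}
    (hne : ∃ d, ∃ β : Γ, ∀ α, β ≤ α → |x α| ≤ d)
    (h : IsGLB {d | ∃ β : Γ, ∀ α, β ≤ α → |x α| ≤ d} 0) : OrderTendsto x 0 := by
  set D := {d | ∃ β : Γ, ∀ α, β ≤ α → |x α| ≤ d}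
  obtain ⟨d₀, hd₀⟩ := hne
  refine ⟨(↥D)ᵒᵈ, inferInstance, ⟨fun a b => ?_⟩, ⟨OrderDual.toDual ⟨d₀, hd₀⟩⟩,
    fun d => (OrderDual.ofDual d : D), fun a b hab => hab, ?_, fun d => ?_⟩
  · obtain ⟨β, hβ⟩ := (OrderDual.ofDual a).2
    obtain ⟨β', hβ'⟩ := (OrderDual.ofDual b).2
    obtain ⟨δ, h1, h2⟩ := exists_ge_ge β β'
    exact ⟨OrderDual.toDual ⟨(OrderDual.ofDual a : D) ⊓ (OrderDual.ofDual b : D), δ,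
      fun α hα => le_inf (hβ α (h1.trans hα)) (hβ' α (h2.trans hα))⟩,
      show (_ : X) ≤ _ from inf_le_left, show (_ : X) ≤ _ from inf_le_right⟩
  · convert h using 1
    exact Subtype.range_coe
  · obtain ⟨β, hβ⟩ := (OrderDual.ofDual d).2
    exact ⟨β, fun α hα => by simpa using hβ α hα⟩

/-! ### The positive part of an order continuous functional -/

section

variable {X : Type u} [NormedAddCommGroup X] [NormedSpace ℝ X] [Lattice X] [IsOrderedAddMonoid X]
  [IsOrderedModule ℝ X] [HasSolidNorm X] {f : X →ₗ[ℝ] ℝ}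

/-- Order continuous functionals are order bounded. -/
theorem IsOrderContinuousFunctional.bddAbove_image_Icc (hf : IsOrderContinuousFunctional f)
    (x : X) : BddAbove (f '' Set.Icc 0 x) := by
  by_contra hb
  have hb' : ∀ n : ℕ, ∃ u ∈ Set.Icc 0 x, (n + 1 : ℝ) < f u := by
    intro n
    obtain ⟨_, ⟨u, hu, rfl⟩, h⟩ := not_bddAbove_iff.mp hb (n + 1)
    exact ⟨u, hu, h⟩
  choose u hu hfu using hb'
  have hx : 0 ≤ x := (hu 0).1.trans (hu 0).2
  have hpos (n : ℕ) : (0 : ℝ) < n + 1 := by positivity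
  have hinv (n : ℕ) : (0 : ℝ) ≤ (n + 1 : ℝ)⁻¹ := by positivity
  -- `u n / (n + 1)` is dominated by `x / (n + 1) ↓ 0`, yet `f` exceeds `1` on it. `ULift` only
  -- adjusts the universe.
  have hanti : Antitone fun n : ULift.{u} ℕ => (n.down + 1 : ℝ)⁻¹ • x := by
    intro m n hmn
    have hmn' : (m.down : ℝ) ≤ n.down := by exact_mod_cast hmn
    have := hpos m.down
    exact smul_le_smul_of_nonneg_right (by gcongr) hx
  have hglb : IsGLB (Set.range fun n : ULift.{u} ℕ => (n.down + 1 : ℝ)⁻¹ • x) 0 := by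
    refine ⟨?_, fun v hv => ?_⟩
    · rintro _ ⟨n, rfl⟩
      exact smul_nonneg (hinv _) hx
    · have hv0 : v ⊔ 0 = 0 := by
        refine eq_zero_of_forall_nsmul_le (w := x) le_sup_right fun n => ?_
        have h1 : v ⊔ 0 ≤ (n + 1 : ℝ)⁻¹ • x :=
          sup_le (hv ⟨ULift.up n, rfl⟩) (smul_nonneg (hinv n) hx)
        have h2 := smul_le_smul_of_nonneg_left h1 (hpos n).le
        rw [smul_inv_smul₀ (hpos n).ne'] at h2
        have h3 : n • (v ⊔ 0) ≤ (n + 1) • (v ⊔ 0) :=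
          nsmul_le_nsmul_left le_sup_right (Nat.le_succ n)
        refine h3.trans ?_
        rw [← Nat.cast_smul_eq_nsmul ℝ]
        exact_mod_cast h2
      exact sup_eq_right.mp hv0
  have ht := hf (ULift.{u} ℕ) (fun n => (n.down + 1 : ℝ)⁻¹ • u n.down)
    (OrderTendsto.of_antitone hanti hglb fun n => by
      rw [abs_of_nonneg (smul_nonneg (hinv _) (hu _).1)]
      exact smul_le_smul_of_nonneg_left (hu _).2 (hinv _))
  obtain ⟨n, hn⟩ := (ht.eventually_lt_const one_pos).exists
  rw [map_smul, smul_eq_mul, inv_mul_lt_iff₀ (hpos _), mul_one] at hn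
  exact lt_asymm hn (hfu _)

namespace IsOrderContinuousFunctional

theorem le_rieszPosPart (hf : IsOrderContinuousFunctional f) {u x : X} (hu : 0 ≤ u)
    (hux : u ≤ x) : f u ≤ rieszPosPart f x :=
  le_csSup (hf.bddAbove_image_Icc x) ⟨u, ⟨hu, hux⟩, rfl⟩

theorem rieszPosPart_nonneg (hf : IsOrderContinuousFunctional f) {x : X} (hx : 0 ≤ x) :
    0 ≤ rieszPosPart f x := by
  simpa using hf.le_rieszPosPart le_rfl hx

theorem rieszPosPart_mono (hf : IsOrderContinuousFunctional f) {x y : X} (hx : 0 ≤ x)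
    (hxy : x ≤ y) : rieszPosPart f x ≤ rieszPosPart f y :=
  csSup_le_csSup (hf.bddAbove_image_Icc y) ⟨f 0, 0, ⟨le_rfl, hx⟩, rfl⟩
    (Set.image_mono (Set.Icc_subset_Icc_right hxy))

theorem rieszPosPart_add (hf : IsOrderContinuousFunctional f) {x y : X} (hx : 0 ≤ x)
    (hy : 0 ≤ y) : rieszPosPart f (x + y) = rieszPosPart f x + rieszPosPart f y := by
  apply le_antisymm
  -- Riesz decomposition: `u = u ⊓ x + (u - u ⊓ x)`.
  · refine rieszPosPart_le (add_nonneg hx hy) fun u hu hux => ?_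
    have h1 := hf.le_rieszPosPart (le_inf hu hx) (inf_le_right : u ⊓ x ≤ x)
    have h2 : u - u ⊓ x ≤ y := by
      rw [sub_le_comm]
      exact le_inf (sub_le_self u hy) (sub_le_iff_le_add.mpr hux)
    have h3 := hf.le_rieszPosPart (sub_nonneg.mpr (inf_le_left : u ⊓ x ≤ u)) h2
    rw [map_sub] at h3
    linarith
  · rw [← le_sub_iff_add_le]
    refine rieszPosPart_le hx fun u hu hux => ?_
    rw [le_sub_comm]
    refine rieszPosPart_le hy fun v hv hvy => ?_
    rw [le_sub_iff_add_le', ← map_add]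
    exact hf.le_rieszPosPart (add_nonneg hu hv) (add_le_add hux hvy)

theorem rieszPosPart_sub (hf : IsOrderContinuousFunctional f) {x y : X} (hx : 0 ≤ x)
    (hxy : x ≤ y) : rieszPosPart f (y - x) = rieszPosPart f y - rieszPosPart f x := by
  have := hf.rieszPosPart_add hx (sub_nonneg.mpr hxy)
  rw [add_sub_cancel] at this
  linarith

theorem rieszPosPart_nsmul (hf : IsOrderContinuousFunctional f) {x : X} (hx : 0 ≤ x) (n : ℕ) :
    rieszPosPart f (n • x) = n * rieszPosPart f x := by
  induction n with
  | zero =>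
    have := hf.rieszPosPart_add (le_refl (0 : X)) le_rfl
    rw [add_zero] at this
    simp only [zero_smul, Nat.cast_zero, zero_mul]
    linarith
  | succ n ih =>
    rw [succ_nsmul, hf.rieszPosPart_add (nsmul_nonneg hx n) hx, ih]
    push_cast
    ring

/-- The positive part of an order continuous functional is order continuous. -/
theorem exists_rieszPosPart_lt (hf : IsOrderContinuousFunctional f) {S : Set X}
    (hne : S.Nonempty) (hdir : DirectedOn (· ≥ ·) S) (hS : IsGLB S 0) {ε : ℝ} (hε : 0 < ε) :
    ∃ s ∈ S, rieszPosPart f s < ε := by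
  obtain ⟨x, hxS⟩ := hne
  have hx : 0 ≤ x := hS.1 hxS
  -- `y` nearly attains `f⁺ x`. As `y - y ⊓ t ≤ x - t`, we get `f⁺ t ≤ f⁺ x - f y + f (y ⊓ t)`, and
  -- the last term tends to `0`.
  obtain ⟨_, ⟨y, hy, rfl⟩, hlt⟩ : ∃ r ∈ f '' Set.Icc 0 x, rieszPosPart f x - ε / 2 < r :=
    exists_lt_of_lt_csSup ⟨f 0, 0, ⟨le_rfl, hx⟩, rfl⟩ (sub_lt_self _ (half_pos hε))
  have : Nonempty (↥S)ᵒᵈ := ⟨OrderDual.toDual ⟨x, hxS⟩⟩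
  have : IsDirectedOrder (↥S)ᵒᵈ := ⟨fun a b => by
    obtain ⟨c, hc, hca, hcb⟩ := hdir _ (OrderDual.ofDual a).2 _ (OrderDual.ofDual b).2
    exact ⟨OrderDual.toDual ⟨c, hc⟩, hca, hcb⟩⟩
  have ht := hf (↥S)ᵒᵈ (fun s => y ⊓ (OrderDual.ofDual s : S))
    (OrderTendsto.of_antitone (a := fun s => ((OrderDual.ofDual s : S) : X))
      (fun a b hab => hab)
      (by
        convert hS using 1
        exact Subtype.range_coe)
      fun s => by
        rw [abs_of_nonneg (le_inf hy.1 (hS.1 (OrderDual.ofDual s).2))]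
        exact inf_le_right)
  obtain ⟨s, hs, hsx⟩ := ((ht.eventually_lt_const (half_pos hε)).and
    (eventually_ge_atTop (OrderDual.toDual (⟨x, hxS⟩ : S)))).exists
  set t : X := ((OrderDual.ofDual s : S) : X)
  have htS : t ∈ S := (OrderDual.ofDual s).2
  have ht0 : 0 ≤ t := hS.1 htS
  have htx : t ≤ x := hsx
  refine ⟨t, htS, ?_⟩
  have h1 : y - y ⊓ t ≤ x - t := by
    rw [sub_le_comm, le_inf_iff]
    refine ⟨sub_le_self _ (sub_nonneg.mpr htx), ?_⟩
    rw [sub_le_iff_le_add, add_sub_cancel]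
    exact hy.2
  have h2 := hf.le_rieszPosPart (sub_nonneg.mpr (inf_le_left : y ⊓ t ≤ y)) h1
  rw [hf.rieszPosPart_sub ht0 htx, map_sub] at h2
  linarith

/-- The positive part of an order continuous functional on a Banach lattice is bounded on norm
bounded sets of positive elements. -/
theorem bddAbove_range_rieszPosPart [CompleteSpace X] (hf : IsOrderContinuousFunctional f)
    {ι : Type v} {x : ι → X} (hx : ∀ i, 0 ≤ x i) {M : ℝ} (hM : ∀ i, ‖x i‖ ≤ M) :
    BddAbove (Set.range fun i => rieszPosPart f (x i)) := by
  by_contra hb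
  -- Growth `4 ^ n` beats the weights `2⁻ⁿ` that make the series converge: its sum `s` would have
  -- `f⁺ s > 2 ^ n` for all `n`.
  have hb' : ∀ n : ℕ, ∃ i, (4 : ℝ) ^ n < rieszPosPart f (x i) := by
    intro n
    obtain ⟨_, ⟨i, rfl⟩, h⟩ := not_bddAbove_iff.mp hb (4 ^ n)
    exact ⟨i, h⟩
  choose i hi using hb'
  have hnonneg (n : ℕ) : 0 ≤ ((2 : ℝ) ^ n)⁻¹ • x (i n) := smul_nonneg (by positivity) (hx _)
  have hsum : Summable fun n : ℕ => ((2 : ℝ) ^ n)⁻¹ • x (i n) := by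
    refine Summable.of_norm_bounded (g := fun n : ℕ => ((1 : ℝ) / 2) ^ n * M)
      (summable_geometric_two.mul_right M) fun n => ?_
    rw [norm_smul, Real.norm_of_nonneg (by positivity), one_div, inv_pow]
    exact mul_le_mul_of_nonneg_left (hM _) (by positivity)
  set s := ∑' n : ℕ, ((2 : ℝ) ^ n)⁻¹ • x (i n)
  have key (n : ℕ) : (2 : ℝ) ^ n < rieszPosPart f s := by
    have h1 := hf.rieszPosPart_mono (hnonneg n) (hsum.le_tsum n fun m _ => hnonneg m)
    have h2 := hf.rieszPosPart_nsmul (hnonneg n) (2 ^ n)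
    rw [← Nat.cast_smul_eq_nsmul ℝ, Nat.cast_pow, Nat.cast_ofNat,
      smul_inv_smul₀ (by positivity)] at h2
    have h3 := hi n
    rw [h2, show (4 : ℝ) = 2 * 2 by norm_num, mul_pow] at h3
    exact (lt_of_mul_lt_mul_left h3 (by positivity)).trans_le h1
  obtain ⟨n, hn⟩ := pow_unbounded_of_one_lt (rieszPosPart f s) (one_lt_two : (1 : ℝ) < 2)
  exact lt_asymm hn (key n)

end IsOrderContinuousFunctional

/-! ### Increasing nets are uo-Cauchy -/

/-- For an order continuous functional, the positive part of a supremum of an upward directed set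
is approximated, even if the supremum does not exist. -/
theorem IsOrderContinuousFunctional.exists_upperBound_rieszPosPart_lt
    (hf : IsOrderContinuousFunctional f) {W : Set X} (hne : W.Nonempty)
    (hW0 : ∀ w ∈ W, 0 ≤ w) (hdir : DirectedOn (· ≤ ·) W) (hb : BddAbove W) {c : ℝ}
    (hc : ∀ w ∈ W, rieszPosPart f w ≤ c) {ε : ℝ} (hε : 0 < ε) :
    ∃ u ∈ upperBounds W, rieszPosPart f u < c + ε := by
  obtain ⟨_, ⟨u, hu, w, hw, rfl⟩, hlt⟩ := hf.exists_rieszPosPart_lt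
    (by
      obtain ⟨u, hu⟩ := hb
      obtain ⟨w, hw⟩ := hne
      exact ⟨_, u, hu, w, hw, rfl⟩)
    (by
      rintro _ ⟨u, hu, w, hw, rfl⟩ _ ⟨u', hu', w', hw', rfl⟩
      obtain ⟨z, hz, hwz, hwz'⟩ := hdir w hw w' hw'
      exact ⟨_, ⟨u ⊓ u', fun a ha => le_inf (hu ha) (hu' ha), z, hz, rfl⟩,
        sub_le_sub inf_le_left hwz, sub_le_sub inf_le_right hwz'⟩)
    (isGLB_upperBounds_sub hne hb) hε
  refine ⟨u, hu, ?_⟩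
  rw [hf.rieszPosPart_sub (hW0 w hw) (hu hw)] at hlt
  have := hc w hw
  linarith

/-- If the order continuous dual of a Banach lattice separates points, then norm bounded increasing
nets of positive elements are uo-Cauchy. -/
theorem OrderContinuousDualSeparates.uoCauchy [CompleteSpace X]
    (h : OrderContinuousDualSeparates X) {Γ : Type v} [Preorder Γ] [IsDirectedOrder Γ]
    [Nonempty Γ] {x : Γ → X} (hx : ∀ α, 0 ≤ x α) (hmono : Monotone x) {M : ℝ}
    (hM : ∀ α, ‖x α‖ ≤ M) : UOCauchy x := by
  intro y hy
  have habs (p : Γ × Γ) : |(|x p.1 - x p.2 - 0| ⊓ y)| = |x p.1 - x p.2| ⊓ y := by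
    rw [sub_zero, abs_of_nonneg (le_inf (abs_nonneg _) hy)]
  have : IsDirectedOrder (Γ × Γ) := ⟨fun p q => by
    obtain ⟨a, ha, ha'⟩ := exists_ge_ge p.1 q.1
    obtain ⟨b, hb, hb'⟩ := exists_ge_ge p.2 q.2
    exact ⟨(a, b), ⟨ha, hb⟩, ⟨ha', hb'⟩⟩⟩
  refine OrderTendsto.of_isGLB
    ⟨y, (Classical.arbitrary Γ, Classical.arbitrary Γ), fun p _ => by
      rw [habs]
      exact inf_le_right⟩ ⟨?_, fun v hv => ?_⟩
  · rintro d ⟨β, hβ⟩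
    exact (abs_nonneg _).trans (hβ β le_rfl)
  · by_contra hv0
    have hz : v ⊔ 0 ≠ 0 := fun h0 => hv0 (sup_eq_right.mp h0)
    obtain ⟨f, hf, hfz⟩ := h.exists_pos hz
    have hbdd := hf.bddAbove_range_rieszPosPart hx hM
    set s := ⨆ α, rieszPosPart f (x α)
    obtain ⟨β, hβ⟩ : ∃ β, s - f (v ⊔ 0) / 2 < rieszPosPart f (x β) :=
      exists_lt_of_lt_ciSup (sub_lt_self _ (half_pos hfz))
    set w : Γ → X := fun δ => (x δ - x β) ⊓ y
    have hw : Monotone w := fun δ δ' hδ => inf_le_inf_right y (sub_le_sub_right (hmono hδ) _)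
    obtain ⟨u, hu, hlt⟩ := hf.exists_upperBound_rieszPosPart_lt (W := w '' Set.Ici β)
      (c := s - rieszPosPart f (x β)) (ε := f (v ⊔ 0) / 2)
      ⟨_, β, le_refl β, rfl⟩
      (by
        rintro _ ⟨δ, hδ, rfl⟩
        exact le_inf (sub_nonneg.mpr (hmono hδ)) hy)
      (by
        rintro _ ⟨δ, hδ, rfl⟩ _ ⟨δ', hδ', rfl⟩
        obtain ⟨η, h1, h2⟩ := exists_ge_ge δ δ'
        exact ⟨_, ⟨η, le_trans hδ h1, rfl⟩, hw h1, hw h2⟩)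
      ⟨y, by
        rintro _ ⟨δ, _, rfl⟩
        exact inf_le_right⟩
      (by
        rintro _ ⟨δ, hδ, rfl⟩
        have h1 := hf.rieszPosPart_mono (le_inf (sub_nonneg.mpr (hmono hδ)) hy)
          (inf_le_left : w δ ≤ x δ - x β)
        rw [hf.rieszPosPart_sub (hx β) (hmono hδ)] at h1
        have h2 : rieszPosPart f (x δ) ≤ s := le_ciSup hbdd δ
        linarith)
      (half_pos hfz)
    have hud : ∃ b : Γ × Γ, ∀ p, b ≤ p → |(|x p.1 - x p.2 - 0| ⊓ y)| ≤ u := by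
      refine ⟨(β, β), fun p hp => ?_⟩
      rw [habs]
      -- For `δ` above both indices, `|x p.1 - x p.2| ≤ x δ - x β`.
      obtain ⟨δ, h1, h2⟩ := exists_ge_ge p.1 p.2
      refine le_trans (inf_le_inf_right y ?_) (hu ⟨δ, le_trans hp.1 h1, rfl⟩)
      rw [abs_le']
      exact ⟨sub_le_sub (hmono h1) (hmono hp.2),
        (neg_sub _ _).trans_le (sub_le_sub (hmono h2) (hmono hp.1))⟩
    have hvu : v ⊔ 0 ≤ u := by
      refine sup_le (hv hud) ?_
      obtain ⟨b, hb⟩ := hud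
      exact (abs_nonneg _).trans (hb b le_rfl)
    have := hf.le_rieszPosPart le_sup_right hvu
    linarith

end

/-! ### Order continuous norms -/

/-- If the norm is order continuous, then bounded functionals are order continuous. -/
theorem IsOrderContinuousNorm.isOrderContinuousFunctional {X : Type u} [NormedAddCommGroup X]
    [NormedSpace ℝ X] [Lattice X] [IsOrderedAddMonoid X] [HasSolidNorm X]
    (h : IsOrderContinuousNorm X) (f : X →L[ℝ] ℝ) :
    IsOrderContinuousFunctional (f : X →ₗ[ℝ] ℝ) := by
  intro Γ _ _ _ x hx
  obtain ⟨Λ, _, _, _, a, ha, ha0, hxa⟩ := hx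
  have hx0 : Tendsto x atTop (𝓝 0) := by
    rw [Metric.tendsto_nhds]
    intro ε hε
    obtain ⟨γ, hγ⟩ := ((h Λ a ha ha0).eventually_lt_const hε).exists
    obtain ⟨α₀, hα₀⟩ := hxa γ
    filter_upwards [eventually_ge_atTop α₀] with α hα
    have h1 : ‖x α‖ ≤ ‖a γ‖ := norm_le_norm_of_abs_le_abs
      (by simpa using (hα₀ α hα).trans (le_abs_self (a γ)))
    simpa using h1.trans_lt hγ
  simpa [Function.comp_def] using (f.continuous.tendsto 0).comp hx0

theorem IsOrderContinuousNorm.orderContinuousDualSeparates {X : Type u} [NormedAddCommGroup X]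
    [NormedSpace ℝ X] [Lattice X] [IsOrderedAddMonoid X] [HasSolidNorm X]
    (h : IsOrderContinuousNorm X) : OrderContinuousDualSeparates X := by
  intro x y hxy
  obtain ⟨f, hf⟩ := SeparatingDual.exists_separating_of_ne (R := ℝ) hxy
  exact ⟨f, h.isOrderContinuousFunctional f, hf⟩

theorem theorem2p3 {X : Type u} [NormedAddCommGroup X] [NormedSpace ℝ X] [CompleteSpace X]
    [Lattice X] [IsOrderedAddMonoid X] [IsOrderedModule ℝ X] [HasSolidNorm X] :
    (OrderContinuousDualSeparates X →
      ∀ (Γ : Type v) [Preorder Γ] [IsDirectedOrder Γ] [Nonempty Γ] (x : Γ → X),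
        (∀ α, 0 ≤ x α) → Monotone x → (∃ M : ℝ, ∀ α, ‖x α‖ ≤ M) → UOCauchy x) ∧
    (IsOrderContinuousNorm X → OrderContinuousDualSeparates X) :=
  ⟨fun h _ _ _ _ _ hx hmono ⟨_, hM⟩ => h.uoCauchy hx hmono hM,
    fun h => h.orderContinuousDualSeparates⟩
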